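/- **Theorem (Orbit Type Stratification).** *Setting.* Manifolds are Hausdorff smooth manifolds modelled on (arbitrary, real, Hausdorff) locally convex spaces, where the model space may vary from chart to chart; smoothness is in the sense of Michal–Bastiani. A subset $N\subseteq M$ is a *submanifold* if around each of its points there are a chart $\varphi:U\to E$ of $M$ and a closed linear subspace $P\subseteq E$ with $\varphi(U\cap N)=\varphi(U)\cap P$. Let $G$ be a Lie group (modelled on a locally convex space) acting smoothly on a manifold $M$. For $m\in M$ let $G_m$ be its stabilizer and $(G_m)$ the conjugacy class of $G_m$; conjugacy classes of subgroups are compared by $(H)\le(\tilde H)$ iff $aHa^{-1}\subseteq\tilde H$ for some $a\in G$. Put $$M_{(H)}=\{m\in M: (G_m)=(H)\},\qquad M_{\ge(H)}=\{m\in M: (H)\le(G_m)\}.$$ The action is *proper* if inverse images of compact sets under the map $G\times M\to M\times M$, $(g,m)\mapsto(g\cdot m,m)$, are compact. A Lie subgroup $H$ of $G$ (a subgroup that is a submanifold) is *principal* if $G/H$ carries a smooth structure such that $G\to G/H$ is a smooth principal $H$-bundle. A *slice* at $m\in M$ is a submanifold $S\subseteq M$ containing $m$ such that 1. $G_m\cdot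 S\subseteq S$; 2. if $g\in G$ and $(g\cdot S)\cap S\ne\emptyset$, then $g\in G_m$; 3. $G_m$ is a principal Lie subgroup of $G$, and $G\to G/G_m$ has a smooth local section $\chi:U\to G$ on an open neighborhood $U$ of the identity coset such that $U\times S\to M$, $([g],s)\mapsto\chi([g])\cdot s$, is a diffeomorphism onto an open neighborhood of $m$; 4. $S_{(G_m)}=\{s\in S: G_s \text{ is conjugate to } G_m\}$ is a closed submanifold of $S$. A *stratification* of a Hausdorff space $X$ is a partition of $X$ into nonempty locally closed subsets $X_\sigma$, each a manifold in its relative topology, such that any two disjoint pieces with $X_\varsigma\cap\overline{X_\sigma}\neq\emptyset$ satisfy $X_\varsigma\subseteq\overline{X_\sigma}\setminus X_\sigma$ and $X_\sigma\cap\overline{X_\varsigma}=\emptyset$. In this case one writes $X_\varsigma<X_\sigma$; and $X_\varsigma\le X_\sigma$ means $X_\varsigma<X_\sigma$ or $X_\varsigma=X_\sigma$. *Statement.* Suppose that the action of $G$ on $M$ is proper, that there is a slice at every point of $M$, and that $M_{\ge(H)}\subseteq\overline{M_{(H)}}$ for every stabilizer subgroup $H\subseteq G$. Then each orbit type subset $M_{(H)}$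 ($H$ a stabilizer) is a locally closed submanifold of $M$, and the partition of $M$ into these submanifolds is a stratification. The relation $\le$ is a partial order on the set of conjugacy classes of stabilizers, and the frontier order of the strata is opposite to it: for all stabilizers $H,K$, $$M_{(K)}\le M_{(H)}\iff M_{(K)}\subseteq\overline{M_{(H)}}\iff (H)\le(K).$$ -/

import Mathlib

open Set Filter Topology

universe u v w

/-! ### Differential calculus on locally convex spaces -/

/-- The directional derivative of `f` at `x` in the direction `v` exists and equals `L`. -/
def HasDirDeriv {E : Type u} {F : Type v} [AddCommGroup E] [Module ℝ E]
    [AddCommGroup F] [Module ℝ F] [TopologicalSpace F]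
    (f : E → F) (x v : E) (L : F) : Prop :=
  Tendsto (fun t : ℝ => t⁻¹ • (f (x + t • v) - f x)) (𝓝[≠] 0) (𝓝 L)

/-- `f` is of class `C^n` on the (open) set `U` in the sense of Michal and Bastiani:
`f` is continuous on `U`, all directional derivatives exist, and the map
`df : U × E → F` is of class `C^(n-1)`. -/
def BastianiC {F : Type v} [AddCommGroup F] [Module ℝ F] [TopologicalSpace F] :
    ℕ → ∀ {E : Type u} [AddCommGroup E] [Module ℝ E] [TopologicalSpace E],
      (E → F) → Set E → Prop
  | 0, _, _, _, _, f, U => ContinuousOn f U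
  | n + 1, E, _, _, _, f, U => ContinuousOn f U ∧ ∃ df : E × E → F,
      (∀ x ∈ U, ∀ v, HasDirDeriv f x v (df (x, v))) ∧ BastianiC n df (U ×ˢ univ)

/-- Smoothness in the sense of Michal and Bastiani on an open set `U`. -/
def BastianiSmooth {E : Type u} {F : Type v} [AddCommGroup E] [Module ℝ E] [TopologicalSpace E]
    [AddCommGroup F] [Module ℝ F] [TopologicalSpace F] (f : E → F) (U : Set E) : Prop :=
  ∀ n, BastianiC n f U

section Calculus

set_option linter.unusedSectionVars false

variable {E : Type u} {F : Type v} {H : Type w}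
  [AddCommGroup E] [Module ℝ E] [TopologicalSpace E] [IsTopologicalAddGroup E]
  [ContinuousSMul ℝ E]
  [AddCommGroup F] [Module ℝ F] [TopologicalSpace F] [IsTopologicalAddGroup F]
  [ContinuousSMul ℝ F]
  [AddCommGroup H] [Module ℝ H] [TopologicalSpace H] [IsTopologicalAddGroup H]
  [ContinuousSMul ℝ H]

theorem tendsto_line (x v : E) : Tendsto (fun t : ℝ => x + t • v) (𝓝[≠] 0) (𝓝 x) := by
  have h : Continuous (fun t : ℝ => x + t • v) := by fun_prop
  have := h.tendsto 0
  simp only [zero_smul, add_zero] at this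
  exact this.mono_left nhdsWithin_le_nhds

theorem HasDirDeriv.congr {f g : E → F} {U : Set E} (hU : IsOpen U) (h : EqOn f g U) {x v : E}
    (hx : x ∈ U) {L : F} (hf : HasDirDeriv f x v L) : HasDirDeriv g x v L := by
  refine Tendsto.congr' ?_ hf
  filter_upwards [(tendsto_line x v).eventually (hU.mem_nhds hx)] with t ht
  rw [h hx, h ht]

theorem BastianiC.continuousOn {n : ℕ} {f : E → F} {U : Set E} (h : BastianiC n f U) :
    ContinuousOn f U := by
  cases n with
  | zero => exact h
  | succ n => exact h.1

theorem BastianiC.mono (n : ℕ) : ∀ {E : Type u} [AddCommGroup E] [Module ℝ E]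
    [TopologicalSpace E] {f : E → F} {U V : Set E}, BastianiC n f U → V ⊆ U →
    BastianiC n f V := by
  induction n with
  | zero => intro E _ _ _ f U V h hV; exact ContinuousOn.mono h hV
  | succ n ih =>
    intro E _ _ _ f U V h hV
    obtain ⟨h0, df, h1, h2⟩ := h
    exact ⟨h0.mono hV, df, fun x hx => h1 x (hV hx), ih h2 (prod_mono hV subset_rfl)⟩

theorem BastianiC.congr (n : ℕ) {f g : E → F} {U : Set E} (hU : IsOpen U)
    (h : BastianiC n f U) (hfg : EqOn f g U) : BastianiC n g U := by
  cases n with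
  | zero => exact ContinuousOn.congr h fun x hx => (hfg hx).symm
  | succ n =>
    obtain ⟨h0, df, h1, h2⟩ := h
    exact ⟨h0.congr fun x hx => (hfg hx).symm, df,
      fun x hx v => (h1 x hx v).congr hU hfg hx, h2⟩

theorem BastianiC.of_succ (n : ℕ) : ∀ {E : Type u} [AddCommGroup E] [Module ℝ E]
    [TopologicalSpace E] {f : E → F} {U : Set E}, BastianiC (n + 1) f U → BastianiC n f U := by
  induction n with
  | zero => intro E _ _ _ f U h; exact h.1
  | succ n ih =>
    intro E _ _ _ f U h
    obtain ⟨h0, df, h1, h2⟩ := h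
    exact ⟨h0, df, h1, ih h2⟩

/-- Being of class `C^n` is a local property. -/
theorem BastianiC.of_local [T2Space F] (n : ℕ) : ∀ {E : Type u} [AddCommGroup E] [Module ℝ E]
    [TopologicalSpace E] [IsTopologicalAddGroup E] [ContinuousSMul ℝ E] {f : E → F} {U : Set E},
    (∀ x ∈ U, ∃ W, IsOpen W ∧ x ∈ W ∧ BastianiC n f W) → BastianiC n f U := by
  induction n with
  | zero =>
    intro E _ _ _ _ _ f U h x hx
    obtain ⟨W, hW, hxW, hf⟩ := h x hx
    exact (ContinuousOn.continuousAt hf (hW.mem_nhds hxW)).continuousWithinAt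
  | succ n ih =>
    intro E _ _ _ _ _ f U h
    have hex : ∀ x ∈ U, ∀ v, ∃ L, HasDirDeriv f x v L := by
      intro x hx v
      obtain ⟨W, hW, hxW, hf⟩ := h x hx
      obtain ⟨h0, df, h1, h2⟩ := hf
      exact ⟨_, h1 x hxW v⟩
    classical
    let D : E × E → F := fun p => if hp : ∃ L, HasDirDeriv f p.1 p.2 L then hp.choose else 0
    have hD : ∀ {x v L}, HasDirDeriv f x v L → D (x, v) = L := by
      intro x v L hL
      have hp : ∃ L, HasDirDeriv f (x, v).1 (x, v).2 L := ⟨L, hL⟩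
      have : D (x, v) = hp.choose := dif_pos hp
      rw [this]
      exact tendsto_nhds_unique hp.choose_spec hL
    refine ⟨?_, D, ?_, ?_⟩
    · intro x hx
      obtain ⟨W, hW, hxW, hf⟩ := h x hx
      exact (hf.1.continuousAt (hW.mem_nhds hxW)).continuousWithinAt
    · intro x hx v
      obtain ⟨L, hL⟩ := hex x hx v
      rw [hD hL]; exact hL
    · apply ih
      rintro ⟨x, v⟩ ⟨hx, -⟩
      obtain ⟨W, hW, hxW, hf⟩ := h x hx
      obtain ⟨h0, df, h1, h2⟩ := hf
      refine ⟨W ×ˢ univ, hW.prod isOpen_univ, ⟨hxW, mem_univ _⟩,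
        h2.congr n (hW.prod isOpen_univ) ?_⟩
      rintro ⟨y, w⟩ ⟨hy, -⟩
      exact (hD (h1 y hy w)).symm

theorem HasDirDeriv.clm (L : E →L[ℝ] F) (x v : E) : HasDirDeriv L x v (L v) := by
  refine Tendsto.congr' ?_ tendsto_const_nhds
  filter_upwards [self_mem_nhdsWithin] with t ht
  have ht : t ≠ 0 := ht
  simp [smul_smul, inv_mul_cancel₀ ht]

theorem BastianiC.clm (n : ℕ) : ∀ {E : Type u} [AddCommGroup E] [Module ℝ E]
    [TopologicalSpace E] [IsTopologicalAddGroup E] [ContinuousSMul ℝ E] (L : E →L[ℝ] F)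
    (U : Set E), BastianiC n L U := by
  induction n with
  | zero => intro E _ _ _ _ _ L U; exact L.continuous.continuousOn
  | succ n ih =>
    intro E _ _ _ _ _ L U
    exact ⟨L.continuous.continuousOn, L.comp (ContinuousLinearMap.snd ℝ E E),
      fun x _ v => HasDirDeriv.clm L x v, ih _ _⟩

theorem BastianiC.comp_clm (n : ℕ) : ∀ {E : Type u} {E' : Type w}
    [AddCommGroup E] [Module ℝ E] [TopologicalSpace E]
    [AddCommGroup E'] [Module ℝ E'] [TopologicalSpace E']
    {f : E → F} {U : Set E}, BastianiC n f U → ∀ L : E' →L[ℝ] E,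
    BastianiC n (fun x => f (L x)) (L ⁻¹' U) := by
  induction n with
  | zero =>
    intro E E' _ _ _ _ _ _ f U hf L
    exact ContinuousOn.comp hf L.continuous.continuousOn (mapsTo_preimage _ _)
  | succ n ih =>
    intro E E' _ _ _ _ _ _ f U hf L
    obtain ⟨h0, df, h1, h2⟩ := hf
    refine ⟨h0.comp L.continuous.continuousOn (mapsTo_preimage _ _),
      fun p => df (L p.1, L p.2), fun x hx v => ?_, ?_⟩
    · have := h1 (L x) hx (L v)
      simpa [HasDirDeriv] using this
    · exact (ih h2 (L.prodMap L)).mono n fun p hp => ⟨hp.1, mem_univ _⟩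

theorem BastianiC.prodMk (n : ℕ) : ∀ {E : Type u} [AddCommGroup E] [Module ℝ E]
    [TopologicalSpace E] {f : E → F} {g : E → H} {U : Set E}, BastianiC n f U →
    BastianiC n g U → BastianiC n (fun x => (f x, g x)) U := by
  induction n with
  | zero => intro E _ _ _ f g U hf hg; exact ContinuousOn.prodMk hf hg
  | succ n ih =>
    intro E _ _ _ f g U hf hg
    obtain ⟨h0, df, h1, h2⟩ := hf
    obtain ⟨k0, dg, k1, k2⟩ := hg
    refine ⟨h0.prodMk k0, fun p => (df p, dg p), fun x hx v => ?_, ih h2 k2⟩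
    exact (h1 x hx v).prodMk_nhds (k1 x hx v)

/-- Lifting to a closed subspace does not change differentiability. -/
theorem BastianiC.codRestrict (n : ℕ) (P : Submodule ℝ F) (hP : IsClosed (P : Set F)) :
    ∀ {E : Type u} [AddCommGroup E] [Module ℝ E] [TopologicalSpace E] [IsTopologicalAddGroup E]
    [ContinuousSMul ℝ E] {f : E → F} {g : E → P} {U : Set E}, IsOpen U → BastianiC n f U →
    (∀ x ∈ U, (g x : F) = f x) → BastianiC n g U := by
  induction n with
  | zero =>
    intro E _ _ _ _ _ f g U hU hf hg
    refine (Topology.IsInducing.subtypeVal.continuousOn_iff).2 ?_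
    exact ContinuousOn.congr hf hg
  | succ n ih =>
    intro E _ _ _ _ _ f g U hU hf hg
    obtain ⟨h0, df, h1, h2⟩ := hf
    have key : ∀ x ∈ U, ∀ v, HasDirDeriv (fun y => (g y : F)) x v (df (x, v)) :=
      fun x hx v => (h1 x hx v).congr hU (fun y hy => (hg y hy).symm) hx
    have hmem : ∀ x ∈ U, ∀ v, df (x, v) ∈ P := fun x hx v =>
      hP.mem_of_tendsto (key x hx v) (Eventually.of_forall fun t =>
        P.smul_mem _ (P.sub_mem (g _).2 (g _).2))
    classical
    refine ⟨(Topology.IsInducing.subtypeVal.continuousOn_iff).2 (h0.congr hg),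
      fun p => if hp : df p ∈ P then ⟨df p, hp⟩ else 0, fun x hx v => ?_, ?_⟩
    · dsimp only
      rw [dif_pos (hmem x hx v)]
      exact tendsto_subtype_rng.2 (key x hx v)
    · refine ih (hU.prod isOpen_univ) h2 ?_
      rintro ⟨x, v⟩ ⟨hx, -⟩
      rw [dif_pos (hmem x hx v)]

/-- Chain rule for a directional derivative along a curve. -/
theorem HasDirDeriv.comp_curve [LocallyConvexSpace ℝ F] [LocallyConvexSpace ℝ H]
    {g : F → H} {V : Set F} (hV : IsOpen V) {dg : F × F → H}
    (hdg : ∀ z ∈ V, ∀ w, HasDirDeriv g z w (dg (z, w))) (hc : ContinuousOn dg (V ×ˢ univ))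
    {y w : F} (hy : y ∈ V) {γ : ℝ → F} (hγ : Tendsto (fun t : ℝ => t⁻¹ • (γ t - y)) (𝓝[≠] 0) (𝓝 w)) :
    Tendsto (fun t : ℝ => t⁻¹ • (g (γ t) - g y)) (𝓝[≠] 0) (𝓝 (dg (y, w))) := by
  refine tendsto_def.2 fun N hN => ?_
  obtain ⟨N', ⟨hN', hN'c⟩, hN'N⟩ := (closed_nhds_basis (dg (y, w))).mem_iff.1 hN
  obtain ⟨C₀, ⟨hC₀, hC₀c⟩, hC₀N⟩ :=
    (LocallyConvexSpace.convex_basis (𝕜 := ℝ) (dg (y, w))).mem_iff.1 hN'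
  have hCc : Convex ℝ (closure C₀) := hC₀c.closure
  have hCN : closure C₀ ⊆ N := (closure_minimal hC₀N hN'c).trans hN'N
  have hca : ContinuousAt dg (y, w) :=
    hc.continuousAt ((hV.prod isOpen_univ).mem_nhds ⟨hy, mem_univ _⟩)
  have h1 : dg ⁻¹' C₀ ∩ V ×ˢ univ ∈ 𝓝 (y, w) :=
    inter_mem (hca hC₀) ((hV.prod isOpen_univ).mem_nhds ⟨hy, mem_univ _⟩)
  rw [nhds_prod_eq] at h1
  obtain ⟨A, hA, B, hB, hAB⟩ := Filter.mem_prod_iff.1 h1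
  obtain ⟨A₀, ⟨hA₀, hA₀c⟩, hA₀A⟩ :=
    (LocallyConvexSpace.convex_basis (𝕜 := ℝ) y).mem_iff.1 hA
  have hγ0 : Tendsto (fun t : ℝ => y + t • (t⁻¹ • (γ t - y))) (𝓝[≠] 0) (𝓝 y) := by
    have : Tendsto (fun t : ℝ => y + t • (t⁻¹ • (γ t - y))) (𝓝[≠] 0) (𝓝 (y + (0 : ℝ) • w)) :=
      tendsto_const_nhds.add ((tendsto_id.mono_left nhdsWithin_le_nhds).smul hγ)
    simpa using this
  filter_upwards [hγ.eventually hB, hγ0.eventually hA₀, self_mem_nhdsWithin] with t htB htA ht0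
  have ht0 : t ≠ 0 := ht0
  apply hCN
  set q : F := t⁻¹ • (γ t - y) with hq
  have hγt : γ t = y + t • q := by simp [hq, smul_smul, mul_inv_cancel₀ ht0]
  by_contra hcon
  obtain ⟨φ, r, hφ1, hφ2⟩ := geometric_hahn_banach_point_closed hCc isClosed_closure hcon
  have hseg : ∀ s ∈ Icc (0 : ℝ) 1, (y + (s * t) • q ∈ V) ∧ dg (y + (s * t) • q, q) ∈ C₀ := by
    intro s hs
    have hmem : y + (s * t) • q ∈ A₀ := by
      have := hA₀c.add_smul_sub_mem (mem_of_mem_nhds hA₀) htA hs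
      simpa [smul_smul] using this
    have := hAB (Set.mk_mem_prod (hA₀A hmem) htB)
    exact ⟨this.2.1, this.1⟩
  have hder : ∀ s ∈ Icc (0 : ℝ) 1, HasDerivAt (fun s => φ (g (y + (s * t) • q)))
      (t * φ (dg (y + (s * t) • q, q))) s := by
    intro s hs
    have h := hdg _ (hseg s hs).1 q
    have h' : HasDerivAt (fun τ : ℝ => φ (g (y + τ • q))) (φ (dg (y + (s * t) • q, q)))
        (s * t) := by
      rw [hasDerivAt_iff_tendsto_slope_zero]
      refine ((φ.continuous.tendsto _).comp h).congr fun τ => ?_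
      simp [add_smul, add_assoc, mul_sub]
    have h'' := h'.comp s ((hasDerivAt_id s).mul_const t)
    simpa [mul_comm, Function.comp_def] using h''
  obtain ⟨s, hs, hse⟩ := exists_hasDerivAt_eq_slope (fun s => φ (g (y + (s * t) • q))) _
    zero_lt_one (fun s hs => (hder s hs).continuousAt.continuousWithinAt)
    (fun s hs => hder s (Ioo_subset_Icc_self hs))
  have hs' := hφ2 _ (subset_closure (hseg s (Ioo_subset_Icc_self hs)).2)
  have : φ (t⁻¹ • (g (γ t) - g y)) = φ (dg (y + (s * t) • q, q)) := by
    simp only [one_mul, zero_mul, zero_smul, add_zero, sub_zero, div_one] at hse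
    rw [map_smul, map_sub, hγt, ← hse, smul_eq_mul, inv_mul_cancel_left₀ ht0]
  rw [this] at hφ1
  exact absurd (hφ1.trans hs') (lt_irrefl _)

/-- Chain rule. -/
theorem BastianiC.comp [LocallyConvexSpace ℝ H] (n : ℕ) : ∀ {E : Type u} {F : Type v}
    [AddCommGroup E] [Module ℝ E] [TopologicalSpace E] [IsTopologicalAddGroup E]
    [ContinuousSMul ℝ E]
    [AddCommGroup F] [Module ℝ F] [TopologicalSpace F] [IsTopologicalAddGroup F]
    [ContinuousSMul ℝ F] [LocallyConvexSpace ℝ F]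
    {f : E → F} {g : F → H} {U : Set E} {V : Set F}, IsOpen U → IsOpen V → BastianiC n g V →
    BastianiC n f U → MapsTo f U V → BastianiC n (fun x => g (f x)) U := by
  induction n with
  | zero =>
    intro E F _ _ _ _ _ _ _ _ _ _ _ f g U V hU hV hg hf hm
    exact ContinuousOn.comp hg hf hm
  | succ n ih =>
    intro E F _ _ _ _ _ _ _ _ _ _ _ f g U V hU hV hg hf hm
    have hfn := hf.of_succ n
    obtain ⟨h0, df, h1, h2⟩ := hf
    obtain ⟨k0, dg, k1, k2⟩ := hg
    refine ⟨k0.comp h0 hm, fun p => dg (f p.1, df p), fun x hx v => ?_, ?_⟩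
    · exact HasDirDeriv.comp_curve hV k1 k2.continuousOn (hm hx) (h1 x hx v)
    · refine ih (f := fun p : E × E => (f p.1, df p)) (hU.prod isOpen_univ)
        (hV.prod isOpen_univ) k2 ?_ (fun p hp => ⟨hm hp.1, mem_univ _⟩)
      refine BastianiC.prodMk n ?_ h2
      exact (hfn.comp_clm n (ContinuousLinearMap.fst ℝ E E)).mono n fun p hp => hp.1

end Calculus

/-! ### Manifolds modelled on locally convex spaces -/

/-- A Hausdorff locally convex real topological vector space. -/
structure LCSpace : Type (u + 1) where
  carrier : Type u
  [addCommGroup : AddCommGroup carrier]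
  [module : Module ℝ carrier]
  [topologicalSpace : TopologicalSpace carrier]
  [isTopologicalAddGroup : IsTopologicalAddGroup carrier]
  [continuousSMul : ContinuousSMul ℝ carrier]
  [locallyConvexSpace : LocallyConvexSpace ℝ carrier]
  [t2Space : T2Space carrier]

attribute [instance] LCSpace.addCommGroup LCSpace.module LCSpace.topologicalSpace
  LCSpace.isTopologicalAddGroup LCSpace.continuousSMul LCSpace.locallyConvexSpace
  LCSpace.t2Space

/-- A chart with values in a locally convex space, which may differ from chart to chart. -/
structure LCChart (M : Type u) [TopologicalSpace M] : Type (u + 1) where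
  model : LCSpace.{u}
  chart : OpenPartialHomeomorph M model.carrier

/-- The transition map from `c` to `d` is smooth. -/
def LCChart.SmoothTransition {M : Type u} [TopologicalSpace M] (c d : LCChart M) : Prop :=
  BastianiSmooth (fun y => d.chart (c.chart.symm y))
    (c.chart.target ∩ c.chart.symm ⁻¹' d.chart.source)

/-- A smooth manifold structure on the topological space `M`, modelled on (varying) locally
convex spaces: an atlas with smooth transition maps. Its topology is the given one. The Hausdorff
axiom is imposed separately. -/
class LCManifold (M : Type u) [TopologicalSpace M] : Type (u + 1) where
  atlas : Set (LCChart M)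
  covers : ∀ x : M, ∃ c ∈ atlas, x ∈ c.chart.source
  compatible : ∀ c ∈ atlas, ∀ d ∈ atlas, c.SmoothTransition d

/-- The charts of `M` that are compatible with the atlas. -/
def LCManifold.maxAtlas (M : Type u) [TopologicalSpace M] [LCManifold M] : Set (LCChart M) :=
  {c | ∀ d ∈ LCManifold.atlas (M := M), c.SmoothTransition d ∧ d.SmoothTransition c}

theorem LCManifold.atlas_subset_maxAtlas (M : Type u) [TopologicalSpace M] [LCManifold M] :
    LCManifold.atlas (M := M) ⊆ LCManifold.maxAtlas M := fun _ hc d hd =>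
  ⟨LCManifold.compatible _ hc d hd, LCManifold.compatible d hd _ hc⟩

theorem LCChart.isOpen_transition {M : Type u} [TopologicalSpace M] (c d : LCChart M) :
    IsOpen (c.chart.target ∩ c.chart.symm ⁻¹' d.chart.source) :=
  c.chart.symm.isOpen_inter_preimage d.chart.open_source

theorem LCManifold.compatible_of_mem_maxAtlas {M : Type u} [TopologicalSpace M] [LCManifold M]
    {c d : LCChart M} (hc : c ∈ LCManifold.maxAtlas M) (hd : d ∈ LCManifold.maxAtlas M) :
    c.SmoothTransition d := by
  intro n
  refine BastianiC.of_local n fun y hy => ?_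
  obtain ⟨e, he, hye⟩ := LCManifold.covers (c.chart.symm y)
  have h1 := (hc e he).1 n
  have h2 := (hd e he).2 n
  let W := (c.chart.target ∩ c.chart.symm ⁻¹' d.chart.source) ∩
    (c.chart.target ∩ c.chart.symm ⁻¹' e.chart.source)
  have hW : IsOpen W := (c.isOpen_transition d).inter (c.isOpen_transition e)
  have hm : MapsTo (fun y => e.chart (c.chart.symm y)) W
      (e.chart.target ∩ e.chart.symm ⁻¹' d.chart.source) := by
    intro z hz
    refine ⟨e.chart.map_source hz.2.2, ?_⟩
    simpa [e.chart.left_inv hz.2.2] using hz.1.2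
  refine ⟨W, hW, ⟨hy, hy.1, hye⟩, ?_⟩
  refine (BastianiC.comp n hW (e.isOpen_transition d) h2 (h1.mono n inter_subset_right)
    hm).congr n hW ?_
  intro z hz
  simp [e.chart.left_inv hz.2.2]

/-- Smoothness of a map on an open subset `U` of a manifold: continuity, and smoothness of all
local representatives. -/
def ManifoldSmoothOn {M : Type u} {N : Type v} [TopologicalSpace M] [LCManifold M]
    [TopologicalSpace N] [LCManifold N] (f : M → N) (U : Set M) : Prop :=
  ContinuousOn f U ∧ ∀ c ∈ LCManifold.atlas (M := M), ∀ d ∈ LCManifold.atlas (M := N),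
    BastianiSmooth (fun y => d.chart (f (c.chart.symm y)))
      (c.chart.target ∩ c.chart.symm ⁻¹' (U ∩ f ⁻¹' d.chart.source))

/-- A diffeomorphism from an open subset of `M` (the source) onto an open subset of `N`
(the target). -/
def IsLocalDiffeo {M : Type u} {N : Type v} [TopologicalSpace M] [LCManifold M]
    [TopologicalSpace N] [LCManifold N] (e : OpenPartialHomeomorph M N) : Prop :=
  ManifoldSmoothOn e e.source ∧ ManifoldSmoothOn e.symm e.target

section Product

variable {M : Type u} {N : Type v} [TopologicalSpace M] [TopologicalSpace N]

/-- The product of two locally convex spaces. -/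
def LCSpace.prod (E : LCSpace.{u}) (F : LCSpace.{v}) : LCSpace.{max u v} where
  carrier := E.carrier × F.carrier
  locallyConvexSpace := inferInstance

/-- The product chart. -/
def LCChart.prod (c : LCChart M) (d : LCChart N) : LCChart (M × N) where
  model := c.model.prod d.model
  chart := c.chart.prod d.chart

theorem LCChart.SmoothTransition.prod {c c' : LCChart M} {d d' : LCChart N}
    (h : c.SmoothTransition c') (k : d.SmoothTransition d') :
    (c.prod d).SmoothTransition (c'.prod d') := by
  intro n
  have h1 := (h n).comp_clm n (ContinuousLinearMap.fst ℝ c.model.carrier d.model.carrier)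
  have h2 := (k n).comp_clm n (ContinuousLinearMap.snd ℝ c.model.carrier d.model.carrier)
  refine BastianiC.prodMk n (h1.mono n ?_) (h2.mono n ?_)
  · rintro p ⟨hp1, hp2⟩
    exact ⟨hp1.1, hp2.1⟩
  · rintro p ⟨hp1, hp2⟩
    exact ⟨hp1.2, hp2.2⟩

/-- The product manifold. -/
instance LCManifold.prod [LCManifold M] [LCManifold N] : LCManifold (M × N) where
  atlas := {e | ∃ c ∈ LCManifold.atlas (M := M), ∃ d ∈ LCManifold.atlas (M := N), e = c.prod d}
  covers := by
    rintro ⟨x, y⟩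
    obtain ⟨c, hc, hx⟩ := LCManifold.covers x
    obtain ⟨d, hd, hy⟩ := LCManifold.covers y
    exact ⟨c.prod d, ⟨c, hc, d, hd, rfl⟩, ⟨hx, hy⟩⟩
  compatible := by
    rintro _ ⟨c, hc, d, hd, rfl⟩ _ ⟨c', hc', d', hd', rfl⟩
    exact (LCManifold.compatible c hc c' hc').prod (LCManifold.compatible d hd d' hd')

end Product

/-! ### Submanifolds -/

/-- The chart `c` of `M` identifies `N`, on the domain of `c`, with the closed linear subspace `P`
of the model space. -/
structure LCChart.IsAdapted {M : Type u} [TopologicalSpace M] (c : LCChart M) (N : Set M)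
    (P : Submodule ℝ c.model.carrier) : Prop where
  isClosed : IsClosed (P : Set c.model.carrier)
  mem_iff : ∀ x ∈ c.chart.source, x ∈ N ↔ c.chart x ∈ P

/-- A subset `N` of `M` is a submanifold if around each of its points there is a chart
`φ : U → E` of `M` and a closed subspace `P` of `E` such that `φ (U ∩ N) = φ U ∩ P`. -/
def IsSubmanifold {M : Type u} [TopologicalSpace M] [LCManifold M] (N : Set M) : Prop :=
  ∀ x ∈ N, ∃ c ∈ LCManifold.maxAtlas M, x ∈ c.chart.source ∧
    ∃ P : Submodule ℝ c.model.carrier, c.IsAdapted N P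

section Submanifold

variable {M : Type u} [TopologicalSpace M] {N : Set M} {c d : LCChart M}
  {P : Submodule ℝ c.model.carrier} {Q : Submodule ℝ d.model.carrier}

theorem LCChart.IsAdapted.symm_mem (h : c.IsAdapted N P) {y : c.model.carrier}
    (hy : y ∈ c.chart.target) (hP : y ∈ P) : c.chart.symm y ∈ N :=
  (h.mem_iff _ (c.chart.map_target hy)).2 (by rwa [c.chart.right_inv hy])

open Classical in
/-- The chart of `N` obtained by restricting an adapted chart of `M`. The point `x₀` is only used
to assign values outside of the target of the chart. -/
noncomputable def LCChart.IsAdapted.restrict (h : c.IsAdapted N P) (x₀ : N) : LCChart N where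
  model := { carrier := P, locallyConvexSpace := inferInstance }
  chart :=
    { toFun := fun x => if hx : c.chart x ∈ P then ⟨c.chart x, hx⟩ else 0
      invFun := fun y => if hy : c.chart.symm y ∈ N then ⟨c.chart.symm y, hy⟩ else x₀
      source := {x | (x : M) ∈ c.chart.source}
      target := {y | (y : c.model.carrier) ∈ c.chart.target}
      map_source' := by
        rintro ⟨x, hxN⟩ hx
        have hx : x ∈ c.chart.source := hx
        have := (h.mem_iff x hx).1 hxN
        simpa [this] using c.chart.map_source hx
      map_target' := by
        rintro ⟨y, hyP⟩ hy
        have hy : y ∈ c.chart.target := hy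
        have := h.symm_mem hy hyP
        simpa [this] using c.chart.map_target hy
      left_inv' := by
        rintro ⟨x, hxN⟩ hx
        have hx : x ∈ c.chart.source := hx
        have := (h.mem_iff x hx).1 hxN
        simp [this, c.chart.left_inv hx, hxN]
      right_inv' := by
        rintro ⟨y, hyP⟩ hy
        have hy : y ∈ c.chart.target := hy
        have := h.symm_mem hy hyP
        simp [this, c.chart.right_inv hy, hyP]
      open_source := c.chart.open_source.preimage continuous_subtype_val
      open_target := c.chart.open_target.preimage continuous_subtype_val
      continuousOn_toFun := by
        refine (Topology.IsInducing.subtypeVal.continuousOn_iff).2 ?_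
        refine ContinuousOn.congr (f := fun x : N => c.chart x)
          (c.chart.continuousOn.comp continuous_subtype_val.continuousOn fun x hx => hx) ?_
        intro x hx
        have := (h.mem_iff x hx).1 x.2
        simp [this]
      continuousOn_invFun := by
        refine (Topology.IsInducing.subtypeVal.continuousOn_iff).2 ?_
        refine ContinuousOn.congr (f := fun y : P => c.chart.symm y)
          (c.chart.symm.continuousOn.comp continuous_subtype_val.continuousOn fun x hx => hx) ?_
        intro y hy
        have := h.symm_mem hy y.2
        simp [this] }

open Classical in
theorem LCChart.IsAdapted.restrict_apply (h : c.IsAdapted N P) (x₀ : N) {x : N}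
    (hx : (x : M) ∈ c.chart.source) :
    ((show P from (h.restrict x₀).chart x) : c.model.carrier) = c.chart x := by
  have hP := (h.mem_iff x hx).1 x.2
  change ((dite (c.chart x ∈ P) (fun hx => ⟨c.chart x, hx⟩) fun _ => 0 : P) :
    c.model.carrier) = _
  rw [dif_pos hP]

open Classical in
theorem LCChart.IsAdapted.restrict_symm_apply (h : c.IsAdapted N P) (x₀ : N) {y : P}
    (hy : (y : c.model.carrier) ∈ c.chart.target) :
    ((h.restrict x₀).chart.symm y : M) = c.chart.symm y := by
  have hN := h.symm_mem hy y.2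
  change ((dite (c.chart.symm y ∈ N) (fun hy => ⟨c.chart.symm y, hy⟩) fun _ => x₀ : N) : M) = _
  rw [dif_pos hN]

theorem LCChart.IsAdapted.smoothTransition (h : c.IsAdapted N P) (k : d.IsAdapted N Q)
    (x₀ x₁ : N) (hcd : c.SmoothTransition d) :
    (h.restrict x₀).SmoothTransition (k.restrict x₁) := by
  intro n
  have h1 := (hcd n).comp_clm n P.subtypeL
  have hO := (h.restrict x₀).isOpen_transition (k.restrict x₁)
  have hsub : ((h.restrict x₀).chart.target ∩
      (h.restrict x₀).chart.symm ⁻¹' (k.restrict x₁).chart.source) ⊆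
      P.subtypeL ⁻¹' (c.chart.target ∩ c.chart.symm ⁻¹' d.chart.source) := by
    intro y hy
    refine ⟨hy.1, ?_⟩
    have h2 : ((h.restrict x₀).chart.symm y : M) ∈ d.chart.source := hy.2
    rw [h.restrict_symm_apply x₀ hy.1] at h2
    exact h2
  refine BastianiC.codRestrict n Q k.isClosed hO (h1.mono n hsub) ?_
  intro y hy
  have h2 : ((h.restrict x₀).chart.symm y : M) ∈ d.chart.source := hy.2
  have h3 := k.restrict_apply x₁ h2
  rw [h.restrict_symm_apply x₀ hy.1] at h3
  exact h3

/-- The manifold structure of a submanifold, given by the restrictions of all adapted charts. Its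
topology is the relative topology. -/
@[reducible]
noncomputable def IsSubmanifold.manifold [LCManifold M] (hN : IsSubmanifold N) :
    LCManifold N where
  atlas := {e | ∃ c ∈ LCManifold.maxAtlas M, ∃ (P : Submodule ℝ c.model.carrier)
    (h : c.IsAdapted N P) (x₀ : N), e = h.restrict x₀}
  covers := by
    intro x
    obtain ⟨c, hc, hx, P, h⟩ := hN x x.2
    exact ⟨h.restrict x, ⟨c, hc, P, h, x, rfl⟩, hx⟩
  compatible := by
    rintro _ ⟨c, hc, P, h, x₀, rfl⟩ _ ⟨d, hd, Q, k, x₁, rfl⟩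
    exact h.smoothTransition k x₀ x₁ (LCManifold.compatible_of_mem_maxAtlas hc hd)

end Submanifold

/-! ### Lie groups, actions and slices -/

/-- A Lie group: a Hausdorff manifold whose group operations are smooth. -/
class IsLocallyConvexLieGroup (G : Type v) [Group G] [TopologicalSpace G] [LCManifold G] :
    Prop where
  t2Space : T2Space G
  smooth_mul : ManifoldSmoothOn (fun p : G × G => p.1 * p.2) univ
  smooth_inv : ManifoldSmoothOn (fun g : G => g⁻¹) univ

/-- The action of `G` on `M` is smooth. -/
class IsSmoothAction (G : Type v) (M : Type u) [Group G] [TopologicalSpace G] [LCManifold G]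
    [TopologicalSpace M] [LCManifold M] [MulAction G M] : Prop where
  smooth_smul : ManifoldSmoothOn (fun p : G × M => p.1 • p.2) univ

/-- The action is proper: the map `G × M → M × M`, `(g, m) ↦ (g • m, m)` is continuous and inverse
images of compact sets under it are compact. -/
structure IsProperAction (G : Type v) (M : Type u) [Group G] [TopologicalSpace G]
    [TopologicalSpace M] [MulAction G M] : Prop where
  continuous : Continuous (fun p : G × M => (p.1 • p.2, p.2))
  isCompact_preimage : ∀ K : Set (M × M), IsCompact K →
    IsCompact ((fun p : G × M => (p.1 • p.2, p.2)) ⁻¹' K)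

/-- The quotient topology on `G ⧸ H` together with the manifold structure `[LCManifold (G ⧸ H)]`
makes `G → G ⧸ H` a smooth principal bundle with structure group the Lie subgroup `H` (acting from
the right): there are smooth local trivializations `U × H → π⁻¹(U)` around each point, which
are fibre preserving and `H`-equivariant. -/
def IsPrincipalQuotient {G : Type v} [Group G] [TopologicalSpace G] [LCManifold G]
    (H : Subgroup G) [LCManifold H] [LCManifold (G ⧸ H)] : Prop :=
  ∀ q : G ⧸ H, ∃ U : Set (G ⧸ H), IsOpen U ∧ q ∈ U ∧
    ∃ e : OpenPartialHomeomorph ((G ⧸ H) × H) G,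
      e.source = U ×ˢ univ ∧ e.target = (QuotientGroup.mk : G → G ⧸ H) ⁻¹' U ∧
      IsLocalDiffeo e ∧
      ∀ u ∈ U, ∀ h k : H, (e (u, h) : G ⧸ H) = u ∧ e (u, h * k) = e (u, h) * k

/-- The conjugacy class `(H)` of a subgroup `H`. -/
def conjClass {G : Type v} [Group G] (H : Subgroup G) : Set (Subgroup G) :=
  {K | ∃ a : G, K = H.map (MulAut.conj a).toMonoidHom}

/-- The order of conjugacy classes of subgroups: `(H) ≤ (H')` if `K ⊆ K'` for some
representatives. -/
def ConjClassLE {G : Type v} [Group G] (σ τ : Set (Subgroup G)) : Prop :=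
  ∃ K ∈ σ, ∃ K' ∈ τ, K ≤ K'

/-- `S` is a slice at `m` for the action of `G` on `M`. -/
structure IsSlice (G : Type v) {M : Type u} [Group G] [TopologicalSpace G] [LCManifold G]
    [TopologicalSpace M] [LCManifold M] [MulAction G M] (m : M) (S : Set M) : Prop where
  mem : m ∈ S
  isSubmanifold : IsSubmanifold S
  smul_mem : ∀ g ∈ MulAction.stabilizer G m, ∀ s ∈ S, g • s ∈ S
  mem_stabilizer : ∀ g : G, (∃ s ∈ S, g • s ∈ S) → g ∈ MulAction.stabilizer G m
  /-- The stabilizer `G_m` is a principal Lie subgroup, and for some smooth local section `χ` of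
  `G → G ⧸ G_m` on a neighbourhood `U` of the identity coset the map `U × S → M`,
  `(q, s) ↦ χ q • s` is a diffeomorphism onto an open neighbourhood of `m`. -/
  exists_section : ∃ (hH : IsSubmanifold (MulAction.stabilizer G m : Set G))
    (_ : LCManifold (G ⧸ MulAction.stabilizer G m)),
    letI : LCManifold (MulAction.stabilizer G m) := hH.manifold
    letI : LCManifold S := isSubmanifold.manifold
    IsPrincipalQuotient (MulAction.stabilizer G m) ∧
    ∃ (U : Set (G ⧸ MulAction.stabilizer G m)) (χ : G ⧸ MulAction.stabilizer G m → G),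
      IsOpen U ∧ ((1 : G) : G ⧸ MulAction.stabilizer G m) ∈ U ∧
      ManifoldSmoothOn χ U ∧ (∀ q ∈ U, (χ q : G ⧸ MulAction.stabilizer G m) = q) ∧
      ∃ e : OpenPartialHomeomorph ((G ⧸ MulAction.stabilizer G m) × S) M,
        e.source = U ×ˢ univ ∧ m ∈ e.target ∧ (∀ q ∈ U, ∀ s : S, e (q, s) = χ q • (s : M)) ∧
        IsLocalDiffeo e
  /-- The partial slice `S_(G_m)` is a closed submanifold of `S`. -/
  partial_slice :
    letI : LCManifold S := isSubmanifold.manifold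
    IsClosed {s : S | MulAction.stabilizer G (s : M) ∈ conjClass (MulAction.stabilizer G m)} ∧
    IsSubmanifold {s : S | MulAction.stabilizer G (s : M) ∈ conjClass (MulAction.stabilizer G m)}

/-! ### Orbit types -/

/-- The orbit types of the action of `G` on `M`: the conjugacy classes of stabilizers. -/
def OrbitType (G : Type v) (M : Type u) [Group G] [MulAction G M] : Type v :=
  {σ : Set (Subgroup G) // ∃ m : M, σ = conjClass (MulAction.stabilizer G m)}

/-- The order of orbit types. -/
instance (G : Type v) (M : Type u) [Group G] [MulAction G M] : LE (OrbitType G M) :=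
  ⟨fun σ τ => ConjClassLE σ.1 τ.1⟩

/-- The subset `M_(H)` of points of orbit type `σ = (H)`. -/
def orbitTypeSubset {G : Type v} {M : Type u} [Group G] [MulAction G M] (σ : OrbitType G M) :
    Set M :=
  {m | conjClass (MulAction.stabilizer G m) = σ.1}

/-- The subset `M_{≥ (H)}` of points whose orbit type is at least `σ = (H)`. -/
def orbitTypeSubsetGE {G : Type v} {M : Type u} [Group G] [MulAction G M] (σ : OrbitType G M) :
    Set M :=
  {m | ConjClassLE σ.1 (conjClass (MulAction.stabilizer G m))}

/-! ### Stratifications -/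

/-- A stratification of the Hausdorff space `X`, with strata `Z i`. -/
structure Stratification {X : Type u} [TopologicalSpace X] {ι : Type w} (Z : ι → Set X) :
    Type (max (u + 1) w) where
  t2Space : T2Space X
  nonempty : ∀ i, (Z i).Nonempty
  pairwise_disjoint : ∀ i j, i ≠ j → Disjoint (Z i) (Z j)
  iUnion_eq : ⋃ i, Z i = univ
  isLocallyClosed : ∀ i, IsLocallyClosed (Z i)
  /-- Every stratum is a manifold, with the relative topology. -/
  manifold : ∀ i, LCManifold (Z i)
  /-- The frontier condition. -/
  frontier : ∀ i j, Disjoint (Z i) (Z j) → (Z i ∩ closure (Z j)).Nonempty →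
    Z i ⊆ closure (Z j) \ Z j ∧ Z j ∩ closure (Z i) = ∅

/-- The relation `Z i < Z j` between strata: `Z i` and `Z j` are disjoint, and `Z i` meets the
closure of `Z j`. -/
def FrontierLT {X : Type u} [TopologicalSpace X] {ι : Type w} (Z : ι → Set X) (i j : ι) : Prop :=
  Disjoint (Z i) (Z j) ∧ (Z i ∩ closure (Z j)).Nonempty

/-- The frontier order `Z i ≤ Z j` on strata. -/
def FrontierLE {X : Type u} [TopologicalSpace X] {ι : Type w} (Z : ι → Set X) (i j : ι) : Prop :=
  FrontierLT Z i j ∨ Z i = Z j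

/-! A slice `S` at `m` gives a tube: an open neighbourhood of `m` whose points are uniquely `χ q •
s` with `(q, s) ∈ U × S`. The stabilizer of `χ q • s` is conjugate to `G_s`, and `G_s ⊆ G_m`. Two
facts follow. In the tube, `M_(G_m)` is the product of `U` with the partial slice `S_(G_m)`, a
closed submanifold of `S`; hence orbit type subsets are submanifolds and locally closed
(`IsSlice.orbitTypeSubset_local`). Moreover all orbit types near `m` are at most `(G_m)`
(`IsSlice.conjClassLE`), so if `M_(K)` meets the closure of `M_(H)`, then `(H) ≤ (K)`.

Conversely, `(H) ≤ (K)` puts `M_(K)` inside `M_{≥(H)}`, which lies in the closure of `M_(H)` by the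
approximation hypothesis. So meeting the closure, lying in the closure and `(H) ≤ (K)` are
equivalent.

Antisymmetry is not purely algebraic, since a subgroup can be properly contained in a conjugate of
itself. It comes from topology: if `(H) ≤ (K) ≤ (H)`, then `M_(H)` and `M_(K)` lie in each other's
closures, and local closedness forces them to meet (`IsLocallyClosed.inter_nonempty`), so the types
agree. The frontier condition is then formal.

The submanifold claim hides a universe problem: a product chart on `(G ⧸ G_m) × S` has its model in
`max u v`, whereas charts of `M` need models in `u`. An open part of that model injects into `M`,
which makes the whole model `u`-small (`small_of_isOpen`). -/

/-! ### Charts with models in a larger universe -/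

/-- A topological vector space with a nonempty open `u`-small subset is `u`-small. -/
theorem small_of_isOpen {V : Type w} [AddCommGroup V] [Module ℝ V] [TopologicalSpace V]
    [IsTopologicalAddGroup V] [ContinuousSMul ℝ V] {W : Set V} (hW : IsOpen W) {x : V}
    (hx : x ∈ W) [Small.{u} W] : Small.{u} V := by
  -- Neighbourhoods of `x` are absorbing: `x + v / (n + 1)` lies in `W` for some `n`, and rescaling
  -- its difference from `x` by `n + 1` recovers `v`.
  refine small_of_surjective (α := ℕ × W) (f := fun p => ((p.1 : ℝ) + 1) • ((p.2 : V) - x)) ?_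
  intro v
  have h : Tendsto (fun n : ℕ => x + (1 / ((n : ℝ) + 1)) • v) atTop (𝓝 (x + (0 : ℝ) • v)) :=
    tendsto_const_nhds.add (tendsto_one_div_add_atTop_nhds_zero_nat.smul_const v)
  rw [zero_smul, add_zero] at h
  obtain ⟨n, hn⟩ := (h.eventually (hW.mem_nhds hx)).exists
  refine ⟨(n, ⟨_, hn⟩), ?_⟩
  have hn0 : (n : ℝ) + 1 ≠ 0 := by positivity
  simp [smul_smul, mul_inv_cancel₀ hn0]

/-- The small model of a small locally convex space, with the transported structure. -/
noncomputable def LCSpace.shrink (E : LCSpace.{w}) [Small.{u} E.carrier] : LCSpace.{u} :=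
  -- With the topology induced along the linear equivalence, every axiom pulls back from `E`.
  letI : TopologicalSpace (Shrink.{u} E.carrier) :=
    TopologicalSpace.induced (Shrink.linearEquiv ℝ E.carrier) inferInstance
  { carrier := Shrink.{u} E.carrier
    isTopologicalAddGroup := topologicalAddGroup_induced (Shrink.linearEquiv ℝ E.carrier)
    continuousSMul := continuousSMul_induced (Shrink.linearEquiv ℝ E.carrier)
    locallyConvexSpace := LocallyConvexSpace.induced
      (Shrink.linearEquiv ℝ E.carrier).toLinearMap
    t2Space := T2Space.of_injective_continuous (Shrink.linearEquiv ℝ E.carrier).injective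
      continuous_induced_dom }

/-- The isomorphism of a small locally convex space with its small model. -/
noncomputable def LCSpace.shrinkEquiv (E : LCSpace.{w}) [Small.{u} E.carrier] :
    E.shrink.carrier ≃L[ℝ] E.carrier where
  toLinearEquiv := Shrink.linearEquiv ℝ E.carrier
  continuous_toFun := continuous_induced_dom
  continuous_invFun := continuous_induced_rng.2 <| by
    refine continuous_id.congr fun x => ?_
    exact ((Shrink.linearEquiv ℝ E.carrier).apply_symm_apply x).symm

/-- The projection of a product to the second factor. -/
def LCSpace.prodSnd (E : LCSpace.{u}) (F : LCSpace.{v}) :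
    (E.prod F).carrier →L[ℝ] F.carrier where
  toFun := Prod.snd
  map_add' _ _ := rfl
  map_smul' _ _ := rfl
  cont := continuous_snd

/-- A chart with a small model in another universe, as a chart. -/
noncomputable def LCChart.ofSmall {M : Type u} [TopologicalSpace M] (E : LCSpace.{w})
    [Small.{u} E.carrier] (φ : OpenPartialHomeomorph M E.carrier) : LCChart M where
  model := E.shrink
  chart := φ.transHomeomorph E.shrinkEquiv.symm.toHomeomorph

/-- Passing to the small model only composes with a continuous linear isomorphism, so compatibility
may be checked on `φ` with its original, larger model. -/
theorem LCChart.ofSmall_mem_maxAtlas {M : Type u} [TopologicalSpace M] [LCManifold M]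
    (E : LCSpace.{w}) [Small.{u} E.carrier] (φ : OpenPartialHomeomorph M E.carrier)
    (h : ∀ f ∈ LCManifold.atlas (M := M),
      BastianiSmooth (fun y => f.chart (φ.symm y)) (φ.target ∩ φ.symm ⁻¹' f.chart.source) ∧
      BastianiSmooth (fun y => φ (f.chart.symm y)) (f.chart.target ∩ f.chart.symm ⁻¹' φ.source)) :
    LCChart.ofSmall E φ ∈ LCManifold.maxAtlas M := by
  refine fun f hf => ⟨fun n => ?_, fun n => ?_⟩
  · exact ((h f hf).1 n).comp_clm n (E.shrinkEquiv : E.shrink.carrier →L[ℝ] E.carrier)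
  · exact BastianiC.comp n (f := fun y => φ (f.chart.symm y)) (g := E.shrinkEquiv.symm)
      (f.chart.symm.isOpen_inter_preimage φ.open_source) isOpen_univ
      (BastianiC.clm n (E.shrinkEquiv.symm : E.carrier →L[ℝ] E.shrink.carrier) univ)
      ((h f hf).2 n) (mapsTo_univ _ _)

/-! ### Smooth maps in charts of the maximal atlas -/

theorem LCChart.prod_mem_maxAtlas {M : Type u} {N : Type v} [TopologicalSpace M]
    [TopologicalSpace N] [LCManifold M] [LCManifold N] {c : LCChart M} {d : LCChart N}
    (hc : c ∈ LCManifold.maxAtlas M) (hd : d ∈ LCManifold.maxAtlas N) :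
    c.prod d ∈ LCManifold.maxAtlas (M × N) := by
  rintro _ ⟨c', hc', d', hd', rfl⟩
  exact ⟨(hc c' hc').1.prod (hd d' hd').1, (hc c' hc').2.prod (hd d' hd').2⟩

/-- The local representatives of a smooth map in charts of the maximal atlases are smooth. -/
theorem ManifoldSmoothOn.bastianiSmooth {M : Type u} {N : Type v} [TopologicalSpace M]
    [LCManifold M] [TopologicalSpace N] [LCManifold N] {f : M → N} {U : Set M}
    (hf : ManifoldSmoothOn f U) (hU : IsOpen U) {c : LCChart M} {d : LCChart N}
    (hc : c ∈ LCManifold.maxAtlas M) (hd : d ∈ LCManifold.maxAtlas N) :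
    BastianiSmooth (fun y => d.chart (f (c.chart.symm y)))
      (c.chart.target ∩ c.chart.symm ⁻¹' (U ∩ f ⁻¹' d.chart.source)) := by
  intro n
  refine BastianiC.of_local n fun y hy => ?_
  obtain ⟨c', hc', hyc⟩ := LCManifold.covers (c.chart.symm y)
  obtain ⟨d', hd', hyd⟩ := LCManifold.covers (f (c.chart.symm y))
  have hO : ∀ d : LCChart N, IsOpen (U ∩ f ⁻¹' d.chart.source) := fun d =>
    hf.1.isOpen_inter_preimage hU d.chart.open_source
  -- On `W` the atlas charts `c'` and `d'` can be inserted: the representative factors as the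
  -- transition from `c` to `c'`, the representative in `c'` and `d'`, and the transition from `d'`
  -- to `d`.
  let W := (c.chart.target ∩ c.chart.symm ⁻¹' c'.chart.source) ∩
    ((c.chart.target ∩ c.chart.symm ⁻¹' (U ∩ f ⁻¹' d.chart.source)) ∩
      (c.chart.target ∩ c.chart.symm ⁻¹' (U ∩ f ⁻¹' d'.chart.source)))
  have hW : IsOpen W := (c.isOpen_transition c').inter
    ((c.chart.symm.isOpen_inter_preimage (hO d)).inter
      (c.chart.symm.isOpen_inter_preimage (hO d')))
  refine ⟨W, hW, ⟨⟨hy.1, hyc⟩, hy, hy.1, hy.2.1, hyd⟩, ?_⟩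
  have h1 : BastianiC n (fun y => d'.chart (f (c'.chart.symm (c'.chart (c.chart.symm y))))) W := by
    refine BastianiC.comp n (f := fun y => c'.chart (c.chart.symm y))
      (g := fun y => d'.chart (f (c'.chart.symm y))) hW (c'.chart.symm.isOpen_inter_preimage (hO d'))
      (hf.2 c' hc' d' hd' n) (((hc c' hc').1 n).mono n inter_subset_left) ?_
    intro z hz
    refine ⟨c'.chart.map_source hz.1.2, ?_⟩
    simpa only [mem_preimage, c'.chart.left_inv hz.1.2] using hz.2.2.2
  refine (BastianiC.comp n (g := fun y => d.chart (d'.chart.symm y)) hW (d'.isOpen_transition d) ((hd d' hd').2 n) h1 ?_).congr n hW ?_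
  · intro z hz
    have hz1 : f (c.chart.symm z) ∈ d'.chart.source := hz.2.2.2.2
    have hz2 : f (c.chart.symm z) ∈ d.chart.source := hz.2.1.2.2
    simp only [c'.chart.left_inv hz.1.2]
    refine ⟨d'.chart.map_source hz1, ?_⟩
    simpa only [mem_preimage, d'.chart.left_inv hz1] using hz2
  · intro z hz
    have hz1 : f (c.chart.symm z) ∈ d'.chart.source := hz.2.2.2.2
    simp only [c'.chart.left_inv hz.1.2, d'.chart.left_inv hz1]

/-- If, in a product decomposition of an open subset of `M`, the subset `N` corresponds to
`Q × B` for a submanifold `B` of the second factor, then `N` is a submanifold there. -/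
theorem exists_isAdapted_of_localDiffeo_prod {Q : Type v} {T M : Type u} [TopologicalSpace Q]
    [TopologicalSpace T] [TopologicalSpace M] [LCManifold Q] [LCManifold T] [LCManifold M]
    (e : OpenPartialHomeomorph (Q × T) M) (he : IsLocalDiffeo e) {B : Set T}
    (hB : IsSubmanifold B) {N : Set M} (hN : ∀ x ∈ e.target, x ∈ N ↔ (e.symm x).2 ∈ B)
    {x : M} (hx : x ∈ e.target) (hxN : x ∈ N) :
    ∃ c ∈ LCManifold.maxAtlas M, x ∈ c.chart.source ∧
      ∃ P : Submodule ℝ c.model.carrier, c.IsAdapted N P := by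
  obtain ⟨c, hc, hxc⟩ := LCManifold.covers (e.symm x).1
  obtain ⟨d, hd, hxd, P, hP⟩ := hB _ ((hN x hx).1 hxN)
  have hC := LCChart.prod_mem_maxAtlas (LCManifold.atlas_subset_maxAtlas Q hc) hd
  let E := c.model.prod d.model
  let φ : OpenPartialHomeomorph M E.carrier := e.symm.trans (c.prod d).chart
  have hxφ : x ∈ φ.source := ⟨hx, hxc, hxd⟩
  -- The inverse of `φ` embeds its target into `M`, which lives in universe `u`.
  have : Small.{u} φ.target :=
    small_of_injective (β := M) (f := fun y => φ.symm y) fun y z hyz =>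
      Subtype.ext (φ.symm.injOn y.2 z.2 hyz)
  have : Small.{u} E.carrier := small_of_isOpen φ.open_target (φ.map_source hxφ)
  -- Only the second coordinate decides membership in `N`, so the adapted subspace is the preimage
  -- of `P` under this projection.
  let L : E.shrink.carrier →L[ℝ] d.model.carrier :=
    (c.model.prodSnd d.model).comp (E.shrinkEquiv : E.shrink.carrier →L[ℝ] E.carrier)
  refine ⟨LCChart.ofSmall E φ, LCChart.ofSmall_mem_maxAtlas E φ fun f hf => ⟨fun n => ?_,
    fun n => ?_⟩, hxφ, P.comap L.toLinearMap, ⟨hP.isClosed.preimage L.continuous, ?_⟩⟩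
  · refine (he.1.bastianiSmooth e.open_source hC (LCManifold.atlas_subset_maxAtlas M hf) n).mono
      n ?_
    rintro y ⟨⟨hy1, hy2⟩, hy3⟩
    exact ⟨hy1, hy2, hy3⟩
  · refine (he.2.bastianiSmooth e.open_target (LCManifold.atlas_subset_maxAtlas M hf) hC n).mono
      n ?_
    rintro y ⟨hy1, hy2, hy3⟩
    exact ⟨hy1, hy2, hy3⟩
  · intro y hy
    have hy : y ∈ φ.source := hy
    refine (hN y hy.1).trans ((hP.mem_iff (e.symm y).2 hy.2.2).trans ?_)
    change _ ↔ (E.shrinkEquiv (E.shrinkEquiv.symm (φ y))).2 ∈ P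
    rw [E.shrinkEquiv.apply_symm_apply]
    exact Iff.rfl

/-! ### Orbit types -/

section OrbitTypes

variable {G : Type v} [Group G]

theorem mem_conjClass_self (H : Subgroup G) : H ∈ conjClass H :=
  ⟨1, by ext; simp⟩

theorem Subgroup.map_conj_map_conj (H : Subgroup G) (a b : G) :
    (H.map (MulAut.conj a).toMonoidHom).map (MulAut.conj b).toMonoidHom =
      H.map (MulAut.conj (b * a)).toMonoidHom := by
  rw [Subgroup.map_map]
  congr 1
  ext x
  simp [mul_assoc]

theorem conjClass_map_conj (H : Subgroup G) (a : G) :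
    conjClass (H.map (MulAut.conj a).toMonoidHom) = conjClass H := by
  ext K
  constructor
  · rintro ⟨b, rfl⟩
    exact ⟨b * a, H.map_conj_map_conj a b⟩
  · rintro ⟨b, rfl⟩
    exact ⟨b * a⁻¹, by rw [Subgroup.map_conj_map_conj, inv_mul_cancel_right]⟩

theorem mem_conjClass_iff {H K : Subgroup G} : K ∈ conjClass H ↔ conjClass K = conjClass H := by
  constructor
  · rintro ⟨a, rfl⟩
    exact conjClass_map_conj H a
  · intro h
    exact h ▸ mem_conjClass_self K

/-- Conjugating both representatives by the inverse of the second conjugator turns the larger one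
into `K` itself, so a single conjugating element suffices. -/
theorem conjClassLE_conjClass_iff {H K : Subgroup G} :
    ConjClassLE (conjClass H) (conjClass K) ↔
      ∃ a : G, H.map (MulAut.conj a).toMonoidHom ≤ K := by
  constructor
  · rintro ⟨_, ⟨a, rfl⟩, _, ⟨b, rfl⟩, h⟩
    refine ⟨b⁻¹ * a, ?_⟩
    have := Subgroup.map_mono (f := (MulAut.conj b⁻¹).toMonoidHom) h
    rw [Subgroup.map_conj_map_conj, Subgroup.map_conj_map_conj, inv_mul_cancel] at this
    refine this.trans (le_of_eq ?_)
    ext; simp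
  · rintro ⟨a, h⟩
    exact ⟨_, ⟨a, rfl⟩, K, mem_conjClass_self K, h⟩

variable {M : Type u} [MulAction G M]

/-- Stabilizers along an orbit are conjugate. In a tube this removes the factor `χ q`, leaving only
the slice coordinate. -/
theorem conjClass_stabilizer_smul (g : G) (m : M) :
    conjClass (MulAction.stabilizer G (g • m)) = conjClass (MulAction.stabilizer G m) := by
  rw [MulAction.stabilizer_smul_eq_stabilizer_map_conj]
  exact conjClass_map_conj _ g

theorem OrbitType.le_refl (σ : OrbitType G M) : σ ≤ σ := by
  obtain ⟨_, m, rfl⟩ := σ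
  exact ⟨_, mem_conjClass_self _, _, mem_conjClass_self _, le_rfl⟩

theorem OrbitType.le_trans {ρ σ τ : OrbitType G M} (h : ρ ≤ σ) (k : σ ≤ τ) : ρ ≤ τ := by
  obtain ⟨_, m, rfl⟩ := ρ
  obtain ⟨_, n, rfl⟩ := σ
  obtain ⟨_, o, rfl⟩ := τ
  obtain ⟨a, ha⟩ := conjClassLE_conjClass_iff.1 h
  obtain ⟨b, hb⟩ := conjClassLE_conjClass_iff.1 k
  refine conjClassLE_conjClass_iff.2 ⟨b * a, ?_⟩
  rw [← Subgroup.map_conj_map_conj]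
  exact (Subgroup.map_mono ha).trans hb

theorem orbitTypeSubset_nonempty (σ : OrbitType G M) : (orbitTypeSubset σ).Nonempty := by
  obtain ⟨_, m, rfl⟩ := σ
  exact ⟨m, rfl⟩

theorem orbitTypeSubset_inj {σ τ : OrbitType G M} {m : M} (hσ : m ∈ orbitTypeSubset σ)
    (hτ : m ∈ orbitTypeSubset τ) : σ = τ :=
  Subtype.ext (hσ.symm.trans hτ)

theorem iUnion_orbitTypeSubset : ⋃ σ : OrbitType G M, orbitTypeSubset σ = univ :=
  eq_univ_of_forall fun m => mem_iUnion.2 ⟨⟨_, m, rfl⟩, rfl⟩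

theorem orbitTypeSubset_subset_GE {σ τ : OrbitType G M} (h : σ ≤ τ) :
    orbitTypeSubset τ ⊆ orbitTypeSubsetGE σ := fun m hm => by
  change ConjClassLE _ _
  rw [show conjClass (MulAction.stabilizer G m) = τ.1 from hm]
  exact h

end OrbitTypes

/-! ### Slices -/

/-- A nonempty locally closed subset meets every subset with the same closure. -/
theorem IsLocallyClosed.inter_nonempty {X : Type u} [TopologicalSpace X] {A B : Set X}
    (hA : IsLocallyClosed A) (hne : A.Nonempty) (hAB : A ⊆ closure B) (hBA : B ⊆ closure A) :
    (A ∩ B).Nonempty := by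
  obtain ⟨x, hx⟩ := hne
  -- Near `x` the set `A` is closed: `U ∩ closure A ⊆ A`. Points of `B` in `U` therefore lie in `A`,
  -- and they exist because `x ∈ closure B`.
  obtain ⟨U, hxU, hU, hUA⟩ := ((isLocallyClosed_tfae A).out 0 3 rfl rfl).1 hA x hx
  obtain ⟨y, hyU, hyB⟩ := mem_closure_iff.1 (hAB hx) U hU hxU
  exact ⟨y, hUA ⟨hyU, hBA hyB⟩, hyB⟩

section Slices

variable {G : Type v} {M : Type u} [Group G] [TopologicalSpace G] [LCManifold G]
  [TopologicalSpace M] [LCManifold M] [MulAction G M]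

/-- If `g` fixes `s ∈ S`, then `g • S` meets `S` in `s`, so the second slice axiom applies. -/
theorem IsSlice.stabilizer_le {m : M} {S : Set M} (h : IsSlice G m S) {s : M} (hs : s ∈ S) :
    MulAction.stabilizer G s ≤ MulAction.stabilizer G m := fun g hg =>
  h.mem_stabilizer g ⟨s, hs, by rwa [MulAction.mem_stabilizer_iff.1 hg]⟩

/-- Near a point with a slice, the orbit types are at most that of the point. -/
theorem IsSlice.conjClassLE {m : M} {S : Set M} (h : IsSlice G m S) :
    ∀ᶠ x in 𝓝 m, ConjClassLE (conjClass (MulAction.stabilizer G x))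
      (conjClass (MulAction.stabilizer G m)) := by
  obtain ⟨hH, _, -, U, χ, -, -, -, -, e, hes, hme, heq, -⟩ := h.exists_section
  filter_upwards [e.open_target.mem_nhds hme] with x hx
  have hxs := e.map_target hx
  rw [hes] at hxs
  -- This writes `x` as `χ q • s`, with `(q, s)` its tube coordinates.
  have := heq _ hxs.1 (e.symm x).2
  rw [Prod.mk.eta, e.right_inv hx] at this
  rw [this, conjClass_stabilizer_smul]
  exact ⟨_, mem_conjClass_self _, _, mem_conjClass_self _, h.stabilizer_le (e.symm x).2.2⟩

/-- Around a point with a slice, the subset of its orbit type is a submanifold and closed in some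
neighbourhood. -/
theorem IsSlice.orbitTypeSubset_local {m : M} {S : Set M} (h : IsSlice G m S) {σ : OrbitType G M}
    (hm : m ∈ orbitTypeSubset σ) :
    (∃ c ∈ LCManifold.maxAtlas M, m ∈ c.chart.source ∧
      ∃ P : Submodule ℝ c.model.carrier, c.IsAdapted (orbitTypeSubset σ) P) ∧
    ∃ W, m ∈ W ∧ IsOpen W ∧ W ∩ closure (orbitTypeSubset σ) ⊆ orbitTypeSubset σ := by
  obtain ⟨hH, _, -, U, χ, -, -, -, -, e, hes, hme, heq, he⟩ := h.exists_section
  let _ : LCManifold S := h.isSubmanifold.manifold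
  obtain ⟨hcl, hsub⟩ := h.partial_slice
  -- In tube coordinates the orbit type subset is the full preimage of the partial slice under the
  -- second projection.
  have hN : ∀ x ∈ e.target, x ∈ orbitTypeSubset σ ↔ (e.symm x).2 ∈
      {s : S | MulAction.stabilizer G (s : M) ∈ conjClass (MulAction.stabilizer G m)} := by
    intro x hx
    have hxs := e.map_target hx
    rw [hes] at hxs
    have := heq _ hxs.1 (e.symm x).2
    rw [Prod.mk.eta, e.right_inv hx] at this
    rw [Set.mem_ofPred_eq, mem_conjClass_iff,
      show conjClass (MulAction.stabilizer G m) = σ.1 from hm,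
      ← conjClass_stabilizer_smul (χ (e.symm x).1), ← this]
    rfl
  refine ⟨exists_isAdapted_of_localDiffeo_prod e he hsub hN hme hm, e.target, hme, e.open_target,
    ?_⟩
  rintro x ⟨hx, hxc⟩
  by_contra hxN
  -- As the partial slice is closed in `S`, the tube points off it form an open set that misses the
  -- orbit type subset.
  have ho : IsOpen (e.target ∩ e.symm ⁻¹' (Prod.snd ⁻¹' {s : S | MulAction.stabilizer G (s : M) ∈
      conjClass (MulAction.stabilizer G m)}ᶜ)) :=
    e.symm.isOpen_inter_preimage (hcl.isOpen_compl.preimage continuous_snd)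
  obtain ⟨y, ⟨hy, hyN⟩, hyσ⟩ := mem_closure_iff.1 hxc _ ho ⟨hx, fun h' => hxN ((hN x hx).2 h')⟩
  exact hyN ((hN y hy).1 hyσ)

theorem isSubmanifold_orbitTypeSubset (hslice : ∀ m : M, ∃ S : Set M, IsSlice G m S)
    (σ : OrbitType G M) : IsSubmanifold (orbitTypeSubset σ) := fun m hm =>
  (hslice m).elim fun _ h => (h.orbitTypeSubset_local hm).1

theorem isLocallyClosed_orbitTypeSubset (hslice : ∀ m : M, ∃ S : Set M, IsSlice G m S)
    (σ : OrbitType G M) : IsLocallyClosed (orbitTypeSubset σ) :=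
  ((isLocallyClosed_tfae _).out 0 3 rfl rfl).2 fun m hm =>
    (hslice m).elim fun _ h => (h.orbitTypeSubset_local hm).2

/-- Points of type `σ` occur arbitrarily close to some `m` of type `τ`, and a slice at `m` bounds
the types of nearby points by `τ`. -/
theorem OrbitType.le_of_inter_closure_nonempty (hslice : ∀ m : M, ∃ S : Set M, IsSlice G m S)
    {σ τ : OrbitType G M} (h : (orbitTypeSubset τ ∩ closure (orbitTypeSubset σ)).Nonempty) :
    σ ≤ τ := by
  obtain ⟨m, hm, hmc⟩ := h
  obtain ⟨S, hS⟩ := hslice m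
  obtain ⟨x, hx, hxσ⟩ := mem_closure_iff_nhds.1 hmc _ hS.conjClassLE
  have hx : ConjClassLE _ _ := hx
  rwa [show conjClass (MulAction.stabilizer G x) = σ.1 from hxσ,
    show conjClass (MulAction.stabilizer G m) = τ.1 from hm] at hx

end Slices

/-! ### The orbit type stratification -/

theorem mainTheorem5 {G : Type v} {M : Type u}
    [Group G] [TopologicalSpace G] [LCManifold G] [IsLocallyConvexLieGroup G]
    [TopologicalSpace M] [T2Space M] [LCManifold M]
    [MulAction G M] [IsSmoothAction G M]
    (hproper : IsProperAction G M)
    (hslice : ∀ m : M, ∃ S : Set M, IsSlice G m S)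
    (happrox : ∀ σ : OrbitType G M, orbitTypeSubsetGE σ ⊆ closure (orbitTypeSubset σ)) :
    IsPartialOrder (OrbitType G M) (· ≤ ·) ∧
    ∃ 𝒵 : Stratification (fun σ : OrbitType G M => orbitTypeSubset σ),
      (∀ σ, ∃ h : IsSubmanifold (orbitTypeSubset σ), 𝒵.manifold σ = h.manifold) ∧
      (∀ σ τ : OrbitType G M,
        FrontierLE (fun σ : OrbitType G M => orbitTypeSubset σ) τ σ ↔ σ ≤ τ) ∧
      (∀ σ τ : OrbitType G M, orbitTypeSubset τ ⊆ closure (orbitTypeSubset σ) ↔ σ ≤ τ) := by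
  have hsub : ∀ σ τ : OrbitType G M, σ ≤ τ → orbitTypeSubset τ ⊆ closure (orbitTypeSubset σ) :=
    fun σ τ h => (orbitTypeSubset_subset_GE h).trans (happrox σ)
  have hle : ∀ σ τ : OrbitType G M,
      (orbitTypeSubset τ ∩ closure (orbitTypeSubset σ)).Nonempty → σ ≤ τ :=
    fun σ τ => OrbitType.le_of_inter_closure_nonempty hslice
  have hanti : ∀ σ τ : OrbitType G M, σ ≤ τ → τ ≤ σ → σ = τ := by
    intro σ τ h k
    -- The two strata lie in each other's closures, so local closedness gives a common point.
    obtain ⟨m, hmσ, hmτ⟩ := (isLocallyClosed_orbitTypeSubset hslice σ).inter_nonempty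
      (orbitTypeSubset_nonempty σ) (hsub τ σ k) (hsub σ τ h)
    exact orbitTypeSubset_inj hmσ hmτ
  have hdisj : ∀ σ τ : OrbitType G M, σ ≠ τ → Disjoint (orbitTypeSubset σ) (orbitTypeSubset τ) :=
    fun σ τ hne => disjoint_left.2 fun m hσ hτ => hne (orbitTypeSubset_inj hσ hτ)
  have hnself : ∀ σ : OrbitType G M, ¬ Disjoint (orbitTypeSubset σ) (orbitTypeSubset σ) :=
    fun σ h => (orbitTypeSubset_nonempty σ).ne_empty (disjoint_self.1 h)
  refine ⟨{ refl := OrbitType.le_refl, trans := fun _ _ _ => OrbitType.le_trans,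
            antisymm := hanti },
    { t2Space := inferInstance
      nonempty := orbitTypeSubset_nonempty
      pairwise_disjoint := hdisj
      iUnion_eq := iUnion_orbitTypeSubset
      isLocallyClosed := isLocallyClosed_orbitTypeSubset hslice
      manifold := fun σ => (isSubmanifold_orbitTypeSubset hslice σ).manifold
      frontier := fun τ σ hd hne => ?_ }, 
    fun σ => ⟨isSubmanifold_orbitTypeSubset hslice σ, rfl⟩, fun σ τ => ⟨?_, fun h => ?_⟩,
    fun σ τ => ⟨fun h => ?_, hsub σ τ⟩⟩
  · have hστ := hle σ τ hne
    refine ⟨fun m hm => ⟨hsub σ τ hστ hm, disjoint_left.1 hd hm⟩, ?_⟩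
    -- Were `Z σ` to meet the closure of `Z τ`, both inequalities would hold and antisymmetry would
    -- contradict disjointness.
    by_contra hc
    have := hanti σ τ hστ (hle τ σ (nonempty_iff_ne_empty.2 hc))
    subst this
    exact hnself σ hd
  · rintro (⟨-, hne⟩ | heq)
    · exact hle σ τ hne
    -- Equal strata are nonempty, and a common point determines the orbit type.
    · obtain ⟨m, hm⟩ := orbitTypeSubset_nonempty τ
      have hm' : m ∈ orbitTypeSubset σ := (show orbitTypeSubset τ = orbitTypeSubset σ from heq) ▸ hm
      rw [orbitTypeSubset_inj hm hm']
      exact OrbitType.le_refl σ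
  · by_cases hne : τ = σ
    · exact Or.inr (by rw [hne])
    · obtain ⟨m, hm⟩ := orbitTypeSubset_nonempty τ
      exact Or.inl ⟨hdisj τ σ hne, m, hm, hsub σ τ h hm⟩
  · obtain ⟨m, hm⟩ := orbitTypeSubset_nonempty τ
    exact hle σ τ ⟨m, hm, h hm⟩
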